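/- Conventions. All graphs have a finite vertex set $V=\{1,\dots,n\}$ and finitely many edges (arcs), each carrying a real weight of any sign; parallel edges (arcs) are allowed. The Kirchhoff matrix $L=(\ell_{ij})$ of a weighted multidigraph $\Gamma$ has, for $j\ne i$, $\ell_{ij}$ equal to minus the sum of the weights of all arcs from $j$ to $i$; that of a weighted multigraph $G$ has, for $j\neq i$, $\ell_{ij}$ equal to minus the sum of the weights of all edges between $i$ and $j$; in both cases $\ell_{ii}=-\sum_{j\ne i}\ell_{ij}$. Put $W=I+L$. A rooted forest is a cycleless graph with one marked vertex (root) in each component. A diverging forest is a directed graph which becomes a rooted forest when its arcs are replaced by edges and in which every root is joined by directed paths to all other vertices of its component. The weight $\varepsilon(F)$ of a forest $F$ is the product of the weights of its edges (arcs), equal to $1$ if there are none, and the weight of a finite set of forests is the sum of the weights of its members ($0$ for the empty set). Theorem 7. 1. Let $\Gamma$ be a weighted multidigraph, let $\mathcal F$ be the set of all spanning diverging forests of $\Gamma$, and let $\mathcal F^{j\to i}$ be the set of those in which $i$ and $j$ belong to the same tree, diverging from $j$. If $Q=W^{-1}=(q_{ij})$ exists, then $\varepsilon(\mathcal F)\neq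 0$ and $$q_{ij}=\varepsilon(\mathcal F^{j\to i})/\varepsilon(\mathcal F),\qquad i,j=1,\dots,n.$$ 2. Let $G$ be a weighted multigraph, let $\mathcal F$ be the set of all spanning rooted forests of $G$, and let $\mathcal F^{ji}$ be the set of those in which $i$ and $j$ belong to the same tree, rooted at $j$. If $Q=W^{-1}=(q_{ij})$ exists, then $\varepsilon(\mathcal F)\neq 0$ and $$q_{ij}=\varepsilon(\mathcal F^{ji})/\varepsilon(\mathcal F),\qquad i,j=1,\dots,n.$$ In both cases $\sum_{j=1}^n q_{ij}=1$ for $i=1,\dots,n$. (The matrix $Q$ is therefore called the matrix of relative forest-accessibilities.) -/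

import Mathlib

/-- A weighted multigraph with vertex set `V` and edge set `E`: each edge has an unordered pair of
end vertices and a real weight (conductance) of any sign. Parallel edges are allowed, and so are
loops, which belong to no forest and do not enter the Kirchhoff matrix. -/
structure WeightedMultigraph (V E : Type*) where
  ends : E → Sym2 V
  conductance : E → ℝ

/-- A weighted multidigraph with vertex set `V` and arc set `E`: the arc `e` goes from `tail e` to
`head e` and has a real weight (conductance) of any sign. -/
structure WeightedMultidigraph (V E : Type*) where
  tail : E → V
  head : E → V
  conductance : E → ℝ

namespace WeightedMultigraph

variable {V E : Type*} (G : WeightedMultigraph V E)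

/-- The sum of the weights of all edges between `i` and `j`. -/
def conductanceBetween [DecidableEq V] [Fintype E] (i j : V) : ℝ :=
  ∑ e with G.ends e = s(i, j), G.conductance e

/-- The Kirchhoff matrix: the `(i, j)` entry is minus the sum of the weights of the edges between
`i` and `j` for `i ≠ j`, and the `(i, i)` entry is minus the sum of the other entries of its row. -/
def kirchhoff [Fintype V] [DecidableEq V] [Fintype E] : Matrix V V ℝ :=
  Matrix.of fun i j =>
    if i = j then ∑ k ∈ Finset.univ.erase i, G.conductanceBetween i k
    else -G.conductanceBetween i j

/-- The matrix `W = I + L`. -/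
def W [Fintype V] [DecidableEq V] [Fintype E] : Matrix V V ℝ :=
  1 + G.kirchhoff

/-- A spanning subgraph is given by its edge set `S`. It contains a cycle if, for some `n ≥ 1`,
there are distinct vertices `v 0, …, v (n - 1)` and distinct edges `e 0, …, e (n - 1)` in `S` with
`e i` joining `v i` and `v (i + 1)`, indices modulo `n` (here `n = k + 1`). A loop is a cycle with
`n = 1`, and two parallel edges form a cycle with `n = 2`. -/
def HasCycle (S : Finset E) : Prop :=
  ∃ (k : ℕ) (v : Fin (k + 1) → V) (e : Fin (k + 1) → E),
    Function.Injective v ∧ Function.Injective e ∧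
      ∀ i, e i ∈ S ∧ G.ends (e i) = s(v i, v (i + 1))

/-- The spanning subgraph with edge set `S` is a forest. -/
def IsForest (S : Finset E) : Prop :=
  ¬ G.HasCycle S

/-- `u` and `v` are in the same component of the spanning subgraph with edge set `S`. -/
def SameComponent (S : Finset E) (u v : V) : Prop :=
  Relation.ReflTransGen (fun x y => ∃ e ∈ S, G.ends e = s(x, y)) u v

/-- `(S, R)` is a spanning rooted forest: `S` is the edge set of a spanning forest, and the set `R`
of roots has exactly one vertex in each component. -/
def IsRootedForest (F : Finset E × Finset V) : Prop :=
  G.IsForest F.1 ∧ ∀ v, ∃! r, r ∈ F.2 ∧ G.SameComponent F.1 r v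

/-- The weight of a set of spanning rooted forests: the sum over its members of the product of the
weights of the edges. -/
def weight (𝓕 : Finset (Finset E × Finset V)) : ℝ :=
  ∑ F ∈ 𝓕, ∏ e ∈ F.1, G.conductance e

open Classical in
/-- The set `𝓕` of all spanning rooted forests. -/
noncomputable def rootedForests [Fintype V] [Fintype E] : Finset (Finset E × Finset V) :=
  {F | G.IsRootedForest F}

open Classical in
/-- The set `𝓕^{ij}` of the spanning rooted forests in which `i` and `j` belong to the same tree,
rooted at `i`. -/
noncomputable def rootedForestsAt [Fintype V] [Fintype E] (i j : V) :
    Finset (Finset E × Finset V) :=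
  {F | G.IsRootedForest F ∧ i ∈ F.2 ∧ G.SameComponent F.1 i j}

end WeightedMultigraph

namespace WeightedMultidigraph

variable {V E : Type*} (Γ : WeightedMultidigraph V E)

/-- The multigraph obtained by replacing all arcs by edges. -/
def underlying : WeightedMultigraph V E where
  ends e := s(Γ.tail e, Γ.head e)
  conductance := Γ.conductance

/-- The sum of the weights of all arcs from `i` to `j`. -/
def conductanceFromTo [DecidableEq V] [Fintype E] (i j : V) : ℝ :=
  ∑ e with Γ.tail e = i ∧ Γ.head e = j, Γ.conductance e

/-- The Kirchhoff matrix: the `(i, j)` entry is minus the sum of the weights of the arcs from `j`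
to `i` for `i ≠ j`, and the `(i, i)` entry is minus the sum of the other entries of its row. -/
def kirchhoff [Fintype V] [DecidableEq V] [Fintype E] : Matrix V V ℝ :=
  Matrix.of fun i j =>
    if i = j then ∑ k ∈ Finset.univ.erase i, Γ.conductanceFromTo k i
    else -Γ.conductanceFromTo j i

/-- The matrix `W = I + L`. -/
def W [Fintype V] [DecidableEq V] [Fintype E] : Matrix V V ℝ :=
  1 + Γ.kirchhoff

/-- There is a directed path from `u` to `v` in the spanning subgraph with arc set `S`. -/
def HasPath (S : Finset E) (u v : V) : Prop :=
  Relation.ReflTransGen (fun x y => ∃ e ∈ S, Γ.tail e = x ∧ Γ.head e = y) u v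

/-- `(S, R)` is a spanning diverging forest: it is a rooted forest once the arcs are replaced by
edges, and it contains directed paths from each root to all vertices of its component. -/
def IsDivergingForest (F : Finset E × Finset V) : Prop :=
  Γ.underlying.IsRootedForest F ∧
    ∀ r ∈ F.2, ∀ v, Γ.underlying.SameComponent F.1 r v → Γ.HasPath F.1 r v

/-- The weight of a set of spanning diverging forests: the sum over its members of the product of
the weights of the arcs. -/
def weight (𝓕 : Finset (Finset E × Finset V)) : ℝ :=
  ∑ F ∈ 𝓕, ∏ e ∈ F.1, Γ.conductance e

open Classical in
/-- The set `𝓕` of all spanning diverging forests. -/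
noncomputable def divergingForests [Fintype V] [Fintype E] : Finset (Finset E × Finset V) :=
  {F | Γ.IsDivergingForest F}

open Classical in
/-- The set `𝓕^{i→j}` of the spanning diverging forests in which `i` and `j` belong to the same
tree, diverging from `i`. -/
noncomputable def divergingForestsFromTo [Fintype V] [Fintype E] (i j : V) :
    Finset (Finset E × Finset V) :=
  {F | Γ.IsDivergingForest F ∧ i ∈ F.2 ∧ Γ.underlying.SameComponent F.1 i j}

end WeightedMultidigraph

/-! Row `i` of `W` is `e_i` plus the weighted sum of `e_i - e_y` over the edges that make `y` a
possible parent of `i`. By multilinearity, `det W` is a sum over choices, at each vertex, of nothing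
or one edge to a parent. The matrix of such a choice is the identity minus the parent matrix: it has
determinant 1 if following parents always ends, and 0 otherwise (`det_eq_sum_choices`). For the
adjugate the same expansion keeps only the choices in which `i` has root `j`
(`adjugate_eq_sum_choices`). Terminating choices correspond to rooted forests, each non-root vertex
choosing the edge to its parent (`sum_choices_eq_sum_forests`); if arcs must run from parent to
child, the forests are the diverging ones (`isDivergingForest_choiceForest_iff`). Cramer's rule
gives the quotients, and `W 1 = 1` the row sums. -/

/-! ### Parent maps and their determinants -/

section ParentMaps

variable {V A : Type*}

/-- The parent map `f` sends `x` to `y`: the arc chosen at `x` leads to `y`. -/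
def ParentStep (t : A → V) (f : V → Option A) (x y : V) : Prop :=
  ∃ a, f x = some a ∧ t a = y

/-- A choice of at most one arc at every vertex is well-founded if no infinite chain of parents
exists. -/
def IsWellFoundedChoice (t : A → V) (f : V → Option A) : Prop :=
  WellFounded fun y x => ParentStep t f x y

/-- `j` is a root of the parent map and is reached from `i`. -/
def HasRoot (t : A → V) (f : V → Option A) (i j : V) : Prop :=
  f j = none ∧ Relation.ReflTransGen (ParentStep t f) i j

variable {t : A → V} {f : V → Option A}

theorem hasRoot_of_none {i j : V} (h : f i = none) : HasRoot t f i j ↔ i = j := by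
  constructor
  · rintro ⟨-, hr⟩
    rcases Relation.ReflTransGen.cases_head hr with h' | ⟨c, ⟨a, ha, -⟩, -⟩
    · exact h'
    · simp [h] at ha
  · rintro rfl
    exact ⟨h, .refl⟩

theorem hasRoot_of_some {i j : V} {a : A} (h : f i = some a) :
    HasRoot t f i j ↔ HasRoot t f (t a) j := by
  constructor
  · rintro ⟨hj, hr⟩
    rcases Relation.ReflTransGen.cases_head hr with rfl | ⟨c, ⟨b, hb, rfl⟩, hc⟩
    · simp [h] at hj
    · rw [h, Option.some.injEq] at hb
      subst hb
      exact ⟨hj, hc⟩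
  · rintro ⟨hj, hr⟩
    exact ⟨hj, .head ⟨a, h, rfl⟩ hr⟩

theorem hasRoot_unique {i j k : V}
    (hj : HasRoot t f i j) (hk : HasRoot t f i k) : j = k := by
  obtain ⟨hj0, hj⟩ := hj
  induction hj using Relation.ReflTransGen.head_induction_on with
  | refl => exact (hasRoot_of_none hj0).1 hk
  | head h _ ih =>
    obtain ⟨a, ha, rfl⟩ := h
    exact ih ((hasRoot_of_some ha).1 hk)

theorem IsWellFoundedChoice.exists_hasRoot (hf : IsWellFoundedChoice t f) (i : V) :
    ∃ j, HasRoot t f i j := by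
  induction i using hf.induction with
  | h i ih =>
    cases h : f i with
    | none => exact ⟨i, h, .refl⟩
    | some a =>
      obtain ⟨j, hj⟩ := ih (t a) ⟨a, h, rfl⟩
      exact ⟨j, (hasRoot_of_some h).2 hj⟩

variable [DecidableEq V]

/-- The row of the vertex `i` when the arc chosen at `i` is `o`. -/
def choiceRow (t : A → V) (i : V) : Option A → V → ℝ
  | none => Pi.single i 1
  | some a => Pi.single i 1 - Pi.single (t a) 1

/-- The identity matrix minus the matrix of the parent map. -/
def choiceMatrix (t : A → V) (f : V → Option A) : Matrix V V ℝ :=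
  Matrix.of fun i => choiceRow t i (f i)

variable [Fintype V]

/-- A parent has smaller rank than its child, so ordering vertices by rank makes the matrix
triangular, with identity blocks on each rank. -/
theorem det_choiceMatrix (hf : IsWellFoundedChoice t f) : (choiceMatrix t f).det = 1 := by
  classical
  let r : V → V → Prop := fun y x => ParentStep t f x y
  have : IsWellFounded V r := ⟨hf⟩
  have hlt : ∀ i a, f i = some a → IsWellFounded.rank r (t a) < IsWellFounded.rank r i :=
    fun i a h => IsWellFounded.rank_lt_of_rel ⟨a, h, rfl⟩
  have hb : (choiceMatrix t f).BlockTriangular (fun i => OrderDual.toDual (IsWellFounded.rank r i)) := by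
    intro i j hij
    have hij : IsWellFounded.rank r i < IsWellFounded.rank r j := hij
    have hne : j ≠ i := by rintro rfl; exact lt_irrefl _ hij
    cases h : f i with
    | none => simp [choiceMatrix, choiceRow, h, hne]
    | some a =>
      have : j ≠ t a := by rintro rfl; exact lt_asymm hij (hlt i a h)
      simp [choiceMatrix, choiceRow, h, hne, this]
  rw [hb.det]
  refine Finset.prod_eq_one fun o _ => ?_
  suffices h : (choiceMatrix t f).toSquareBlock
      (fun i => OrderDual.toDual (IsWellFounded.rank r i)) o = 1 by rw [h, Matrix.det_one]
  ext ⟨i, hi⟩ ⟨j, hj⟩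
  have hij : IsWellFounded.rank r i = IsWellFounded.rank r j :=
    OrderDual.toDual.injective (hi.trans hj.symm)
  simp only [Matrix.toSquareBlock, Matrix.toSquareBlockProp, choiceMatrix, Matrix.one_apply,
    Subtype.mk.injEq]
  change choiceRow t i (f i) j = _
  cases h : f i with
  | none => simp [choiceRow, Pi.single_apply, eq_comm]
  | some a =>
    have : j ≠ t a := by rintro rfl; exact (hlt i a h).ne' hij
    simp [choiceRow, Pi.single_apply, this, eq_comm]

/-- The matrix sends the indicator of the vertices with root `j` to `e_j`; as its determinant is 1,
that indicator is column `j` of the adjugate. -/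
theorem adjugate_choiceMatrix (hf : IsWellFoundedChoice t f) {j : V} (hj : f j = none) (i : V)
    [Decidable (HasRoot t f i j)] :
    (choiceMatrix t f).adjugate i j = if HasRoot t f i j then 1 else 0 := by
  classical
  let v : V → ℝ := fun k => if HasRoot t f k j then 1 else 0
  have hv : (choiceMatrix t f).mulVec v = Pi.single j 1 := by
    ext k
    simp only [Matrix.mulVec, choiceMatrix]
    change choiceRow t k (f k) ⬝ᵥ v = _
    cases h : f k with
    | none => simp [choiceRow, v, hasRoot_of_none h, Pi.single_apply]
    | some a =>
      have : k ≠ j := by rintro rfl; simp [hj] at h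
      simp [choiceRow, v, sub_dotProduct, hasRoot_of_some h, this]
  have := congrArg (choiceMatrix t f).adjugate.mulVec hv
  rw [Matrix.mulVec_mulVec, Matrix.adjugate_mul, det_choiceMatrix hf, one_smul,
    Matrix.one_mulVec] at this
  have h2 := congrFun this i
  rw [Matrix.mulVec_single_one] at h2
  simp only [Matrix.col_apply] at h2
  rw [← h2]
  simp only [v]
  congr

/-- A matrix whose rows outside the well-founded part of `f` are those of `choiceMatrix t f` is
singular. -/
theorem det_eq_zero_of_not_isWellFoundedChoice (hf : ¬ IsWellFoundedChoice t f)
    (M : Matrix V V ℝ) (hM : ∀ i, f i ≠ none → M i = choiceMatrix t f i) : M.det = 0 := by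
  classical
  let r : V → V → Prop := fun y x => ParentStep t f x y
  have key : ∀ i, ¬ Acc r i → ∃ a, f i = some a ∧ ¬ Acc r (t a) := by
    intro i hi
    by_contra! h
    refine hi ⟨_, ?_⟩
    rintro y ⟨a, ha, rfl⟩
    exact h a ha
  have hne : ∃ i, ¬ Acc r i := by
    by_contra! h
    exact hf ⟨h⟩
  -- An inaccessible vertex has an inaccessible parent. The rows of the inaccessible block are thus
  -- supported in it and have sum 0, so this block kills the all-ones vector.
  rw [Matrix.twoBlockTriangular_det M (fun i => Acc r i)]
  · refine mul_eq_zero_of_right _ ?_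
    obtain ⟨i₀, hi₀⟩ := hne
    refine Matrix.exists_mulVec_eq_zero_iff.1 ⟨fun _ => 1, fun h => ?_, ?_⟩
    · simpa using congrFun h ⟨i₀, hi₀⟩
    · ext ⟨i, hi⟩
      obtain ⟨a, ha, hta⟩ := key i hi
      have hrow : ∀ k, M i k = (if k = i then 1 else 0) - if k = t a then (1 : ℝ) else 0 := by
        intro k
        rw [hM i (by simp [ha])]
        simp [choiceMatrix, choiceRow, ha, Pi.single_apply]
      have h1 : ∀ x : {k // ¬ Acc r k}, ((x : V) = i) = (x = ⟨i, hi⟩) := by simp [Subtype.ext_iff]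
      have h2 : ∀ x : {k // ¬ Acc r k}, ((x : V) = t a) = (x = ⟨t a, hta⟩) := by
        simp [Subtype.ext_iff]
      simp [Matrix.mulVec, dotProduct, Matrix.toSquareBlockProp, hrow, h1, h2]
  · intro i hi j hj
    obtain ⟨a, ha, hta⟩ := key i hi
    have h1 : j ≠ i := by rintro rfl; exact hi hj
    have h2 : j ≠ t a := by rintro rfl; exact hta hj
    rw [hM i (by simp [ha])]
    simp [choiceMatrix, choiceRow, ha, h1, h2]

/-- The weight of the choice `o` at the vertex `i`. -/
def choiceWeight (w : V → A → ℝ) (i : V) (o : Option A) : ℝ :=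
  o.elim 1 (w i)

variable [Fintype A]

theorem det_sum_smul (u : V → Option A → ℝ) (X : V → Option A → V → ℝ) :
    (Matrix.of fun i => ∑ o, u i o • X i o).det =
      ∑ f : V → Option A, (∏ i, u i (f i)) * (Matrix.of fun i => X i (f i)).det := by
  change Matrix.detRowAlternating.toMultilinearMap _ = _
  have := (Matrix.detRowAlternating (n := V) (R := ℝ)).toMultilinearMap.map_sum
    (fun i o => u i o • X i o)
  refine this.trans (Finset.sum_congr rfl fun f _ => ?_)
  rw [MultilinearMap.map_smul_univ]
  rfl

open Classical in
theorem det_eq_sum_choices (w : V → A → ℝ) (M : Matrix V V ℝ)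
    (hM : ∀ i, M i = ∑ o, choiceWeight w i o • choiceRow t i o) :
    M.det = ∑ f with IsWellFoundedChoice t f, ∏ i, choiceWeight w i (f i) := by
  have : M = Matrix.of fun i => ∑ o, choiceWeight w i o • choiceRow t i o := funext hM
  rw [this, det_sum_smul, Finset.sum_filter]
  refine Finset.sum_congr rfl fun f _ => ?_
  change _ * (choiceMatrix t f).det = _
  split_ifs with hf
  · rw [det_choiceMatrix hf, mul_one]
  · rw [det_eq_zero_of_not_isWellFoundedChoice hf _ fun _ _ => rfl, mul_zero]

open Classical in
theorem adjugate_eq_sum_choices (w : V → A → ℝ) (M : Matrix V V ℝ)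
    (hM : ∀ i, M i = ∑ o, choiceWeight w i o • choiceRow t i o) (i j : V) :
    M.adjugate i j = ∑ f with IsWellFoundedChoice t f ∧ HasRoot t f i j,
      ∏ i, choiceWeight w i (f i) := by
  -- The replaced row is written as a sum over choices with weight 1 on `none` and 0 elsewhere, so
  -- only choices with root `j` survive the expansion.
  have : M.updateRow j (Pi.single i 1) = Matrix.of fun k =>
      ∑ o, (if k = j then if o = none then 1 else 0 else choiceWeight w k o) •
        (if k = j then Pi.single i 1 else choiceRow t k o) := by
    ext k l
    rw [Matrix.updateRow_apply]
    by_cases hk : k = j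
    · simp [hk]
    · simp [hk, hM]
  rw [Matrix.adjugate_apply, this, det_sum_smul, Finset.sum_filter]
  refine Finset.sum_congr rfl fun f _ => ?_
  by_cases hj : f j = none
  · have h1 : ∏ k, (if k = j then if f k = none then 1 else 0 else choiceWeight w k (f k)) =
        ∏ k, choiceWeight w k (f k) := by
      refine Finset.prod_congr rfl fun k _ => ?_
      split_ifs with h h'
      · subst h; simp [hj, choiceWeight]
      · subst h; exact absurd hj h'
      · rfl
    have h2 : (Matrix.of fun k => if k = j then Pi.single i 1 else choiceRow t k (f k)) =
        (choiceMatrix t f).updateRow j (Pi.single i 1) := by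
      ext k l
      rw [Matrix.updateRow_apply]
      by_cases hk : k = j <;> simp [hk, choiceMatrix]
    rw [h1, h2]
    by_cases hf : IsWellFoundedChoice t f
    · rw [← Matrix.adjugate_apply, adjugate_choiceMatrix hf hj]
      simp [hf]
    · rw [det_eq_zero_of_not_isWellFoundedChoice hf]
      · simp [hf]
      · intro k hk
        have : k ≠ j := by rintro rfl; exact hk hj
        ext l
        simp [Matrix.updateRow_apply, this]
  · rw [Finset.prod_eq_zero (Finset.mem_univ j) (by simp [hj])]
    simp [HasRoot, hj]

end ParentMaps

/-! ### Components and cycles of spanning subgraphs -/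

namespace WeightedMultigraph

variable {V E : Type*} (G : WeightedMultigraph V E)

/-- The simple graph in which distinct vertices are adjacent if they are joined by an edge of
`S`. -/
def spanningGraph (S : Finset E) : SimpleGraph V where
  Adj x y := x ≠ y ∧ ∃ e ∈ S, G.ends e = s(x, y)
  symm := ⟨fun _ _ ⟨h, e, he, hxy⟩ => ⟨h.symm, e, he, hxy.trans Sym2.eq_swap⟩⟩
  loopless := ⟨fun _ h => h.1 rfl⟩

variable {G} {S T : Finset E}

theorem SameComponent.single {e : E} (he : e ∈ S) {x y : V} (h : G.ends e = s(x, y)) :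
    G.SameComponent S x y :=
  Relation.ReflTransGen.single ⟨e, he, h⟩

theorem SameComponent.symm {x y : V} (h : G.SameComponent S x y) : G.SameComponent S y x := by
  induction h with
  | refl => exact .refl
  | tail _ h ih =>
    obtain ⟨e, he, h⟩ := h
    exact (SameComponent.single he (h.trans Sym2.eq_swap)).trans ih

theorem SameComponent.mono (hST : S ⊆ T) {x y : V} (h : G.SameComponent S x y) :
    G.SameComponent T x y :=
  Relation.ReflTransGen.mono (fun _ _ ⟨e, he, h⟩ => ⟨e, hST he, h⟩) _ _ h

theorem SameComponent.reachable {x y : V} (h : G.SameComponent S x y) :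
    (G.spanningGraph S).Reachable x y := by
  induction h with
  | refl => exact .refl _
  | @tail b c _ h ih =>
    by_cases hbc : b = c
    · exact hbc ▸ ih
    · exact ih.trans (SimpleGraph.Adj.reachable ⟨hbc, h⟩)

/-- The ends of an edge of a forest are separated when the edge is removed. -/
theorem IsForest.not_sameComponent (hS : G.IsForest S) {e : E} (he : e ∈ S) (hT : T ⊆ S)
    (heT : e ∉ T) {x y : V} (hxy : G.ends e = s(x, y)) : ¬ G.SameComponent T x y := by
  intro h
  obtain ⟨p, hp⟩ := h.reachable.exists_isPath
  have hadj : ∀ i, i < p.length → ∃ a ∈ T, G.ends a = s(p.getVert i, p.getVert (i + 1)) :=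
    fun i hi => (p.adj_getVert_succ hi).2
  have hE : Nonempty E := ⟨e⟩
  choose! g hgT hg using hadj
  have hinj : ∀ i j, i ≤ p.length → j ≤ p.length → p.getVert i = p.getVert j → i = j :=
    fun i j hi hj hij => hp.getVert_injOn hi hj hij
  -- The path in `T` from `x` to `y` is closed by `e` at the last index, where `i + 1` wraps to 0.
  refine hS ⟨p.length, fun i => p.getVert i, fun i => if (i : ℕ) < p.length then g i else e,
    fun i j hij => Fin.ext (hinj i j (by omega) (by omega) hij), fun i j hij => ?_, fun i => ?_⟩
  · dsimp only at hij
    split_ifs at hij with hi hj hj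
    · have := congrArg G.ends hij
      rw [hg _ hi, hg _ hj, Sym2.eq_iff] at this
      rcases this with ⟨h1, -⟩ | ⟨h1, h2⟩
      · exact Fin.ext (hinj _ _ hi.le hj.le h1)
      · have h1 := hinj _ _ (by omega) (by omega) h1
        have h2 := hinj _ _ (by omega) (by omega) h2
        omega
    · exact absurd (hij ▸ hgT _ hi) heT
    · exact absurd (hij ▸ hgT _ hj) heT
    · omega
  · dsimp only
    split_ifs with hi
    · refine ⟨hT (hgT _ hi), ?_⟩
      rw [hg _ hi, Fin.val_add_one_of_lt (by simpa [Fin.lt_def] using hi)]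
    · have : i = Fin.last p.length := Fin.ext (by simp; omega)
      subst this
      simp [he, hxy, Sym2.eq_swap]

/-! ### Rooted forests as well-founded edge choices -/

section EdgeChoice

variable (G) in
/-- The map `f` chooses at each vertex `i` nothing or an edge `e` joining `i` to `y`. -/
def IsEdgeChoice (f : V → Option (E × V)) : Prop :=
  ∀ i e y, f i = some (e, y) → G.ends e = s(i, y)

open Classical in
/-- The chosen edges, and the vertices at which nothing is chosen. -/
noncomputable def choiceForest [Fintype V] [Fintype E] (f : V → Option (E × V)) :
    Finset E × Finset V :=
  (Finset.univ.filter fun e => ∃ i y, f i = some (e, y), Finset.univ.filter fun i => f i = none)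

variable {f f' : V → Option (E × V)}

/-- No edge is chosen at both of its ends. -/
theorem IsEdgeChoice.eq_of_eq_some (hv : G.IsEdgeChoice f)
    (hf : IsWellFoundedChoice Prod.snd f) {i j y z : V} {e : E} (hi : f i = some (e, y))
    (hj : f j = some (e, z)) : i = j := by
  have := (hv _ _ _ hi).symm.trans (hv _ _ _ hj)
  rcases Sym2.eq_iff.1 this with ⟨h, -⟩ | ⟨rfl, rfl⟩
  · exact h
  · exact absurd (⟨_, hj, rfl⟩ : ParentStep Prod.snd f y i)
      (hf.asymmetric _ _ ⟨_, hi, rfl⟩)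

variable [Fintype V] [Fintype E]

theorem mem_choiceForest_fst {e : E} :
    e ∈ (choiceForest f).1 ↔ ∃ i y, f i = some (e, y) := by
  simp [choiceForest]

theorem mem_choiceForest_snd {i : V} : i ∈ (choiceForest f).2 ↔ f i = none := by
  simp [choiceForest]

theorem IsEdgeChoice.sameComponent_of_reflTransGen (hv : G.IsEdgeChoice f) {i j : V}
    (h : Relation.ReflTransGen (ParentStep Prod.snd f) i j) :
    G.SameComponent (choiceForest f).1 i j := by
  refine Relation.ReflTransGen.mono ?_ _ _ h
  rintro x _ ⟨⟨e, y⟩, ha, rfl⟩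
  exact ⟨e, mem_choiceForest_fst.2 ⟨x, y, ha⟩, hv _ _ _ ha⟩

/-- Every chosen edge joins a vertex to its parent, and the two have the same root. -/
theorem IsEdgeChoice.hasRoot_iff_of_sameComponent (hv : G.IsEdgeChoice f) {x y : V}
    (h : G.SameComponent (choiceForest f).1 x y) (j : V) :
    HasRoot Prod.snd f x j ↔ HasRoot Prod.snd f y j := by
  induction h with
  | refl => rfl
  | tail _ h ih =>
    obtain ⟨e, he, h⟩ := h
    obtain ⟨i, z, hi⟩ := mem_choiceForest_fst.1 he
    rw [ih]
    have := hasRoot_of_some (t := Prod.snd) (j := j) hi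
    rcases Sym2.eq_iff.1 (h.symm.trans (hv _ _ _ hi)) with ⟨rfl, rfl⟩ | ⟨rfl, rfl⟩
    · exact this
    · exact this.symm

theorem IsEdgeChoice.sameComponent_iff_hasRoot (hv : G.IsEdgeChoice f) {i j : V} :
    j ∈ (choiceForest f).2 ∧ G.SameComponent (choiceForest f).1 j i ↔
      HasRoot Prod.snd f i j := by
  rw [mem_choiceForest_snd]
  constructor
  · rintro ⟨hj, h⟩
    exact (hv.hasRoot_iff_of_sameComponent h j).1 ⟨hj, .refl⟩
  · rintro ⟨hj, h⟩
    exact ⟨hj, (hv.sameComponent_of_reflTransGen h).symm⟩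

/-- The edges of a cycle are chosen at distinct vertices of the cycle. By counting, every vertex of
the cycle chooses one of them, so its parent is again on the cycle and the chain of parents never
ends. -/
theorem IsEdgeChoice.isForest (hv : G.IsEdgeChoice f) (hf : IsWellFoundedChoice Prod.snd f) :
    G.IsForest (choiceForest f).1 := by
  rintro ⟨k, v, e, -, he, hve⟩
  choose c y hc using fun m => mem_choiceForest_fst.1 (hve m).1
  have hmem : ∀ m, c m ∈ Set.range v ∧ y m ∈ Set.range v := by
    intro m
    rcases Sym2.eq_iff.1 ((hve m).2.symm.trans (hv _ _ _ (hc m))) with ⟨h1, h2⟩ | ⟨h1, h2⟩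
    · exact ⟨⟨_, h1⟩, ⟨_, h2⟩⟩
    · exact ⟨⟨_, h2⟩, ⟨_, h1⟩⟩
  have hcinj : Function.Injective c := by
    intro m n hmn
    have h := hc m
    rw [hmn, hc n, Option.some.injEq, Prod.mk.injEq] at h
    exact he h.1.symm
  choose σ hσ using fun m => (hmem m).1
  have hσ_inj : Function.Injective σ := fun m n h => hcinj (by rw [← hσ m, ← hσ n, h])
  have hσ_surj : Function.Surjective σ := Finite.surjective_of_injective hσ_inj
  have hfalse : ∀ x, x ∉ Set.range v := by
    intro x
    induction x using hf.induction with
    | h x ih =>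
      rintro ⟨m, rfl⟩
      obtain ⟨n, rfl⟩ := hσ_surj m
      exact ih (y n) ⟨_, by rw [hσ]; exact hc n, rfl⟩ (hmem n).2
  exact hfalse (v 0) ⟨0, rfl⟩

theorem IsEdgeChoice.isRootedForest (hv : G.IsEdgeChoice f)
    (hf : IsWellFoundedChoice Prod.snd f) : G.IsRootedForest (choiceForest f) := by
  refine ⟨hv.isForest hf, fun i => ?_⟩
  simp only [hv.sameComponent_iff_hasRoot]
  obtain ⟨j, hj⟩ := hf.exists_hasRoot i
  exact ⟨j, hj, fun k hk => hasRoot_unique hk hj⟩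

/-- Induction from the roots: let `f` choose `e` at `i`, with parent `y`. If `f'` chose `e` at `y`,
so would `f`, and no edge is chosen at two distinct vertices. -/
theorem IsEdgeChoice.eq_of_choiceForest_eq (hv : G.IsEdgeChoice f)
    (hf : IsWellFoundedChoice Prod.snd f) (hv' : G.IsEdgeChoice f')
    (h : choiceForest f = choiceForest f') : f = f' := by
  have hnone : ∀ i, f i = none ↔ f' i = none := fun i => by
    rw [← mem_choiceForest_snd, ← mem_choiceForest_snd, h]
  ext1 i
  induction i using hf.induction with
  | h i ih =>
    cases hi : f i with
    | none => exact ((hnone i).1 hi).symm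
    | some a =>
      obtain ⟨e, y⟩ := a
      have hy := ih y ⟨_, hi, rfl⟩
      have he : e ∈ (choiceForest f').1 := h ▸ mem_choiceForest_fst.2 ⟨i, y, hi⟩
      obtain ⟨j, z, hj⟩ := mem_choiceForest_fst.1 he
      rcases Sym2.eq_iff.1 ((hv _ _ _ hi).symm.trans (hv' _ _ _ hj)) with ⟨rfl, rfl⟩ | ⟨rfl, rfl⟩
      · exact hj.symm
      · have := hv.eq_of_eq_some hf hi (hy.trans hj)
        subst this
        exact hj.symm

/-- Each non-root takes the first edge of a shortest path to its root; the distance to the root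
drops, so parent chains end. -/
theorem IsRootedForest.exists_choice {F : Finset E × Finset V} (hF : G.IsRootedForest F) :
    ∃ f, IsWellFoundedChoice Prod.snd f ∧ G.IsEdgeChoice f ∧ choiceForest f = F := by
  classical
  obtain ⟨S, R⟩ := F
  obtain ⟨hS, hR⟩ := hF
  dsimp only at hS hR
  choose r hr hr_unique using hR
  let d : V → ℕ := fun i => (G.spanningGraph S).dist i (r i)
  have hr_eq : ∀ {x y}, G.SameComponent S x y → r x = r y := fun {x y} h =>
    hr_unique y (r x) ⟨(hr x).1, (hr x).2.trans h⟩
  have hstep : ∀ i, i ∉ R → ∃ a : E × V, a.1 ∈ S ∧ G.ends a.1 = s(i, a.2) ∧ d a.2 < d i := by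
    intro i hi
    obtain ⟨p₀, hp₀⟩ := (hr i).2.symm.reachable.exists_walk_length_eq_dist
    have hne : i ≠ r i := fun h => hi (h ▸ (hr i).1)
    have key : ∀ {z} (p : (G.spanningGraph S).Walk i z), z = r i → p.length = d i →
        ∃ a : E × V, a.1 ∈ S ∧ G.ends a.1 = s(i, a.2) ∧ d a.2 < d i := by
      intro z p hz
      cases p with
      | nil => exact fun _ => absurd hz hne
      | @cons _ y _ h q =>
        intro hp
        obtain ⟨e, he, hey⟩ := h.2
        refine ⟨(e, y), he, hey, ?_⟩
        have hry : r y = z := by rw [hz, hr_eq (SameComponent.single he hey)]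
        have := SimpleGraph.dist_le q
        rw [SimpleGraph.Walk.length_cons] at hp
        simp only [d] at hp ⊢
        rw [hry]
        omega
    exact key p₀ rfl hp₀
  choose g hgS hg hgd using hstep
  let f : V → Option (E × V) := fun i => if h : i ∈ R then none else some (g i h)
  have hsome : ∀ {i a}, f i = some a → ∃ h : i ∉ R, a = g i h := by
    intro i a h
    by_cases hi : i ∈ R
    · simp [f, hi] at h
    · exact ⟨hi, by simpa [f, hi, eq_comm] using h⟩
  have hf : IsWellFoundedChoice Prod.snd f := by
    refine Subrelation.wf (r := InvImage (· < ·) d) ?_ (InvImage.wf d wellFounded_lt)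
    rintro y x ⟨a, ha, rfl⟩
    obtain ⟨h, rfl⟩ := hsome ha
    exact hgd x h
  have hv : G.IsEdgeChoice f := by
    intro i e y h
    obtain ⟨h, ha⟩ := hsome h
    have := hg i h
    rwa [← ha] at this
  have hroots : (choiceForest f).2 = R := by
    ext i
    rw [mem_choiceForest_snd]
    by_cases hi : i ∈ R <;> simp [f, hi]
  have hsub : (choiceForest f).1 ⊆ S := by
    intro e he
    obtain ⟨i, y, h⟩ := mem_choiceForest_fst.1 he
    obtain ⟨h, ha⟩ := hsome h
    have := hgS i h
    rwa [← ha] at this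
  refine ⟨f, hf, hv, Prod.ext (hsub.antisymm fun e he => ?_) hroots⟩
  -- The chosen edges already join every vertex to its root, so an unchosen edge of `S` would close
  -- a cycle.
  by_contra he'
  have hconn : ∀ x, G.SameComponent (choiceForest f).1 (r x) x := by
    intro x
    obtain ⟨j, ⟨hj, hjx⟩, -⟩ := (hv.isRootedForest hf).2 x
    rw [hroots] at hj
    rwa [← hr_unique x j ⟨hj, hjx.mono hsub⟩]
  induction h : G.ends e with
  | h x y =>
    have hxy := hconn x
    rw [hr_eq (SameComponent.single he h)] at hxy
    exact hS.not_sameComponent he hsub he' h (hxy.symm.trans (hconn y))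

/-- Each edge of the forest is chosen at exactly one vertex, and roots contribute the factor 1. -/
theorem IsEdgeChoice.prod_choiceForest (hv : G.IsEdgeChoice f)
    (hf : IsWellFoundedChoice Prod.snd f) (w : V → E × V → ℝ)
    (hw : ∀ i a, f i = some a → w i a = G.conductance a.1) :
    ∏ i, choiceWeight w i (f i) = ∏ e ∈ (choiceForest f).1, G.conductance e := by
  classical
  have h0 : ∀ i ∈ Finset.univ, choiceWeight w i (f i) ≠ 1 → f i ≠ none := by
    intro i _ h h'
    simp [choiceWeight, h'] at h
  rw [← Finset.prod_filter_of_ne h0]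
  symm
  refine Finset.prod_bij (fun e he => (mem_choiceForest_fst.1 he).choose) ?_ ?_ ?_ ?_
  · intro e he
    obtain ⟨y, h⟩ := (mem_choiceForest_fst.1 he).choose_spec
    simp [h]
  · intro e he e' he' heq
    obtain ⟨y, h⟩ := (mem_choiceForest_fst.1 he).choose_spec
    obtain ⟨y', h'⟩ := (mem_choiceForest_fst.1 he').choose_spec
    rw [heq, h', Option.some.injEq, Prod.mk.injEq] at h
    exact h.1.symm
  · intro i hi
    obtain ⟨⟨e, y⟩, h⟩ := Option.ne_none_iff_exists'.1 (Finset.mem_filter.1 hi).2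
    have he := mem_choiceForest_fst.2 ⟨i, y, h⟩
    obtain ⟨y', h'⟩ := (mem_choiceForest_fst.1 he).choose_spec
    exact ⟨e, he, hv.eq_of_eq_some hf h' h⟩
  · intro e he
    obtain ⟨y, h⟩ := (mem_choiceForest_fst.1 he).choose_spec
    rw [h]
    exact (hw _ _ h).symm

open Classical in
/-- The weight of the edge of `a` if `K` admits the choice of `a` at `i`, and `0` otherwise. -/
noncomputable def admissibleWeight (c : E → ℝ) (K : V → E × V → Prop) (i : V) (a : E × V) : ℝ :=
  if K i a then c a.1 else 0

open Classical in
/-- The weighted sum over the well-founded choices of admissible edges is the weighted sum over the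
corresponding rooted forests. -/
theorem sum_choices_eq_sum_forests [DecidableEq V] (K : V → E × V → Prop)
    (hK : ∀ i e y, K i (e, y) → G.ends e = s(i, y)) (P : Finset E × Finset V → Prop)
    (Q : (V → Option (E × V)) → Prop) (hP : ∀ F, P F → G.IsRootedForest F)
    (hPQ : ∀ f, IsWellFoundedChoice Prod.snd f → G.IsEdgeChoice f →
      (P (choiceForest f) ↔ (∀ i a, f i = some a → K i a) ∧ Q f)) :
    ∑ f : V → Option (E × V) with IsWellFoundedChoice Prod.snd f ∧ Q f,
        ∏ i, choiceWeight (admissibleWeight G.conductance K) i (f i) =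
      ∑ F with P F, ∏ e ∈ F.1, G.conductance e := by
  -- A choice with an inadmissible edge has weight 0, so the sum may be restricted to admissible
  -- choices.
  have h0 : ∀ f ∈ Finset.univ.filter
        (fun f : V → Option (E × V) => IsWellFoundedChoice Prod.snd f ∧ Q f),
      ∏ i, choiceWeight (admissibleWeight G.conductance K) i (f i) ≠ 0 →
      ∀ i a, f i = some a → K i a := by
    intro f _ h i a hi
    by_contra hK
    exact h (Finset.prod_eq_zero (Finset.mem_univ i) (by simp [choiceWeight, admissibleWeight, hi, hK]))
  have hedge : ∀ f : V → Option (E × V), (∀ i a, f i = some a → K i a) → G.IsEdgeChoice f :=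
    fun f h i e y hi => hK _ _ _ (h i _ hi)
  rw [← Finset.sum_filter_of_ne h0]
  refine Finset.sum_bij (fun f _ => choiceForest f) ?_ ?_ ?_ ?_
  · intro f hf
    simp only [Finset.mem_filter, Finset.mem_univ, true_and] at hf ⊢
    exact (hPQ f hf.1.1 (hedge f hf.2)).2 ⟨hf.2, hf.1.2⟩
  · intro f hf f' hf' h
    simp only [Finset.mem_filter, Finset.mem_univ, true_and] at hf hf'
    exact (hedge f hf.2).eq_of_choiceForest_eq hf.1.1 (hedge f' hf'.2) h
  · intro F hF
    simp only [Finset.mem_filter, Finset.mem_univ, true_and] at hF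
    obtain ⟨f, hf, hv, rfl⟩ := (hP F hF).exists_choice
    have := (hPQ f hf hv).1 hF
    exact ⟨f, by simp only [Finset.mem_filter, Finset.mem_univ, true_and]; exact ⟨⟨hf, this.2⟩, this.1⟩, rfl⟩
  · intro f hf
    simp only [Finset.mem_filter, Finset.mem_univ, true_and] at hf
    exact (hedge f hf.2).prod_choiceForest hf.1.1 _ fun i a h => if_pos (hf.2 i a h)

end EdgeChoice

end WeightedMultigraph

/-! ### Diverging forests -/

namespace WeightedMultidigraph

variable {V E : Type*} {Γ : WeightedMultidigraph V E} [Fintype V] [Fintype E]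
  {f : V → Option (E × V)}

/-- Parent chains reversed are directed paths from the root when all arcs run from parent to child.
Conversely, the subtree below `i` can be entered only through the arc chosen at `i`; if that arc
leaves `i`, no directed path from the root reaches `i`. -/
theorem isDivergingForest_choiceForest_iff (hf : IsWellFoundedChoice Prod.snd f)
    (hv : Γ.underlying.IsEdgeChoice f) :
    Γ.IsDivergingForest (WeightedMultigraph.choiceForest f) ↔
      ∀ i a, f i = some a → Γ.head a.1 = i ∧ Γ.tail a.1 = a.2 := by
  constructor
  · rintro ⟨-, hpath⟩ i ⟨e, y⟩ hi
    rcases Sym2.eq_iff.1 (hv _ _ _ hi) with ⟨h1, h2⟩ | ⟨h1, h2⟩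
    · exfalso
      obtain ⟨r, hr⟩ := hf.exists_hasRoot i
      have hr' := hv.sameComponent_iff_hasRoot.2 hr
      have key : ∀ x, Γ.HasPath (WeightedMultigraph.choiceForest f).1 r x →
          ¬ Relation.ReflTransGen (ParentStep Prod.snd f) x i := by
        intro x hx
        induction hx with
        | refl =>
          intro h
          have h1 := (hasRoot_of_none (t := Prod.snd) (j := r) hr.1).2 rfl
          rcases Relation.ReflTransGen.cases_head h with rfl | ⟨c, ⟨a, ha, -⟩, -⟩
          · simp [hr.1] at hi
          · simp [hr.1] at ha
        | @tail x z _ h ih =>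
          intro hz
          obtain ⟨a, haS, rfl, rfl⟩ := h
          obtain ⟨p, q, hp⟩ := WeightedMultigraph.mem_choiceForest_fst.1 haS
          rcases Sym2.eq_iff.1 (hv _ _ _ hp) with ⟨rfl, rfl⟩ | ⟨h3, h4⟩
          · exact ih (.head ⟨_, hp, rfl⟩ hz)
          · rcases Relation.ReflTransGen.cases_head hz with h | ⟨c, ⟨b, hb, rfl⟩, hc⟩
            · rw [← h4, h, hi, Option.some.injEq, Prod.mk.injEq] at hp
              obtain ⟨rfl, rfl⟩ := hp
              exact ih (by rw [h1])
            · rw [h4, hp, Option.some.injEq] at hb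
              subst hb
              exact ih (by rw [h3]; exact hc)
      exact key i (hpath r hr'.1 i hr'.2) .refl
    · exact ⟨h2, h1⟩
  · intro h
    refine ⟨hv.isRootedForest hf, fun r hr v hrv => ?_⟩
    obtain ⟨-, hvr⟩ := hv.sameComponent_iff_hasRoot.1 ⟨hr, hrv⟩
    refine Relation.ReflTransGen.mono ?_ _ _ (Relation.ReflTransGen.swap _ _ hvr)
    rintro x y ⟨⟨e, z⟩, ha, rfl⟩
    exact ⟨e, WeightedMultigraph.mem_choiceForest_fst.2 ⟨_, _, ha⟩, (h _ _ ha).symm⟩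

end WeightedMultidigraph

/-! ### Rows of `I + L` and its inverse -/

/-- The rows of `I + L` for the Kirchhoff matrix `L` with off-diagonal entries `-∑ e, w i (e, j)`. -/
theorem one_add_laplacian_row {V E : Type*} [Fintype V] [DecidableEq V] [Fintype E]
    (w : V → E × V → ℝ) (β : V → V → ℝ) (hβ : ∀ i j, β i j = ∑ e, w i (e, j)) (i : V) :
    ((1 : Matrix V V ℝ) + Matrix.of fun i j =>
        if i = j then ∑ k ∈ Finset.univ.erase i, β i k else -β i j) i =
      ∑ o, choiceWeight w i o • choiceRow Prod.snd i o := by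
  have hsum : ∀ j, ∑ x, ∑ e, (if j = x then w i (e, x) else 0) = β i j := fun j => by
    rw [Finset.sum_eq_single j (fun x _ h => by simp [h.symm]) (by simp)]
    simp [hβ]
  ext j
  simp only [Fintype.sum_option, Fintype.sum_prod_type_right, choiceWeight, choiceRow,
    Option.elim_none, Option.elim_some, Matrix.add_apply, Matrix.of_apply,
    Finset.sum_apply, Pi.smul_apply, Pi.sub_apply, smul_eq_mul, Pi.single_apply, Matrix.one_apply,
    mul_sub, Finset.sum_sub_distrib, mul_ite, mul_one, mul_zero, hsum]
  -- The terms with parent `i` contribute `e_i - e_i = 0`, matching the omission of `k = i` on the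
  -- diagonal.
  by_cases h : i = j
  · subst h
    simp [Finset.sum_erase_eq_sub, hβ]
  · simp [h, Ne.symm h]

/-- The inverse of `I + L` has unit row sums. -/
theorem sum_inv_row_eq_one {V A : Type*} [Fintype V] [DecidableEq V] [Fintype A] {t : A → V}
    {w : V → A → ℝ} {M : Matrix V V ℝ} (hM : ∀ i, M i = ∑ o, choiceWeight w i o • choiceRow t i o)
    (hu : IsUnit M) (i : V) : ∑ j, M⁻¹ i j = 1 := by
  -- Rows `e_i - e_y` have sum 0, and the choice `none` adds `e_i` with weight 1.
  have h1 : M.mulVec 1 = 1 := by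
    ext k
    change M k ⬝ᵥ 1 = 1
    rw [hM, sum_dotProduct, Fintype.sum_option]
    simp [choiceWeight, choiceRow, sub_dotProduct]
  have h2 := congrArg M⁻¹.mulVec h1
  rw [Matrix.mulVec_mulVec, Matrix.nonsing_inv_mul _ ((Matrix.isUnit_iff_isUnit_det _).1 hu),
    Matrix.one_mulVec] at h2
  simpa [Matrix.mulVec, dotProduct] using (congrFun h2 i).symm

/-- The entries of the inverse of a nonsingular matrix with known determinant and adjugate. -/
theorem inv_apply_eq_div {V : Type*} [Fintype V] [DecidableEq V] {M : Matrix V V ℝ} {d : ℝ}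
    {N : V → V → ℝ} (hd : M.det = d) (hN : ∀ i j, M.adjugate i j = N i j) (hu : IsUnit M) :
    d ≠ 0 ∧ ∀ i j, M⁻¹ i j = N i j / d := by
  subst hd
  refine ⟨((Matrix.isUnit_iff_isUnit_det _).1 hu).ne_zero, fun i j => ?_⟩
  rw [Matrix.inv_def, Ring.inverse_eq_inv', Matrix.smul_apply, hN, smul_eq_mul, div_eq_inv_mul]

/-! ### The matrix forest theorem for multidigraphs -/

namespace WeightedMultidigraph

variable {V E : Type*} [Fintype V] [DecidableEq V] [Fintype E] (Γ : WeightedMultidigraph V E)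

theorem W_row (i : V) : Γ.W i = ∑ o, choiceWeight
    (WeightedMultigraph.admissibleWeight Γ.conductance
      fun i a => Γ.head a.1 = i ∧ Γ.tail a.1 = a.2) i o • choiceRow Prod.snd i o := by
  refine one_add_laplacian_row _ (fun i j => Γ.conductanceFromTo j i) (fun i j => ?_) i
  simp [conductanceFromTo, WeightedMultigraph.admissibleWeight, Finset.sum_filter, and_comm]

theorem det_W : Γ.W.det = Γ.weight Γ.divergingForests := by
  classical
  rw [det_eq_sum_choices _ _ Γ.W_row, weight, divergingForests]
  have := WeightedMultigraph.sum_choices_eq_sum_forests (G := Γ.underlying)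
    (fun i a => Γ.head a.1 = i ∧ Γ.tail a.1 = a.2)
    (fun i e y h => Sym2.eq_iff.2 (.inr ⟨h.2, h.1⟩)) Γ.IsDivergingForest (fun _ => True)
    (fun F hF => hF.1) (fun f hf hv => by
      rw [isDivergingForest_choiceForest_iff hf hv, and_true])
  simp only [and_true] at this
  exact this

theorem adjugate_W (i j : V) :
    Γ.W.adjugate i j = Γ.weight (Γ.divergingForestsFromTo j i) := by
  classical
  rw [adjugate_eq_sum_choices _ _ Γ.W_row, weight, divergingForestsFromTo]
  convert WeightedMultigraph.sum_choices_eq_sum_forests (G := Γ.underlying)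
    (fun i a => Γ.head a.1 = i ∧ Γ.tail a.1 = a.2)
    (fun i e y h => Sym2.eq_iff.2 (.inr ⟨h.2, h.1⟩))
    (fun F => Γ.IsDivergingForest F ∧ j ∈ F.2 ∧ Γ.underlying.SameComponent F.1 j i) _
    (fun F hF => hF.1.1) (fun f hf hv => by
      rw [isDivergingForest_choiceForest_iff hf hv, hv.sameComponent_iff_hasRoot])
  all_goals rfl

end WeightedMultidigraph

/-! ### The matrix forest theorem for multigraphs -/

namespace WeightedMultigraph

variable {V E : Type*} [Fintype V] [DecidableEq V] [Fintype E] (G : WeightedMultigraph V E)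

/-- An edge is admissible at either end, with the other end as parent, so the forests carry no
condition on directions. -/
theorem W_row (i : V) : G.W i = ∑ o, choiceWeight
    (admissibleWeight G.conductance fun i a => G.ends a.1 = s(i, a.2)) i o •
      choiceRow Prod.snd i o := by
  refine one_add_laplacian_row _ G.conductanceBetween (fun i j => ?_) i
  simp [conductanceBetween, admissibleWeight, Finset.sum_filter]

theorem det_W : G.W.det = G.weight G.rootedForests := by
  classical
  rw [det_eq_sum_choices _ _ G.W_row, weight, rootedForests]
  have := sum_choices_eq_sum_forests (G := G) (fun i a => G.ends a.1 = s(i, a.2))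
    (fun i e y h => h) G.IsRootedForest (fun _ => True) (fun F hF => hF)
    (fun f hf hv => iff_of_true (hv.isRootedForest hf) ⟨fun i a h => hv _ _ _ h, trivial⟩)
  simp only [and_true] at this
  exact this

theorem adjugate_W (i j : V) : G.W.adjugate i j = G.weight (G.rootedForestsAt j i) := by
  classical
  rw [adjugate_eq_sum_choices _ _ G.W_row, weight, rootedForestsAt]
  convert sum_choices_eq_sum_forests (G := G) (fun i a => G.ends a.1 = s(i, a.2))
    (fun i e y h => h)
    (fun F => G.IsRootedForest F ∧ j ∈ F.2 ∧ G.SameComponent F.1 j i) _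
    (fun F hF => hF.1) (fun f hf hv => by
      rw [hv.sameComponent_iff_hasRoot]
      exact and_congr_left fun _ =>
        iff_of_true (hv.isRootedForest hf) fun i a h => hv _ _ _ h)

end WeightedMultigraph

theorem theorem7 {V E : Type*} [Fintype V] [DecidableEq V] [Fintype E] :
    (∀ Γ : WeightedMultidigraph V E, IsUnit Γ.W →
      Γ.weight Γ.divergingForests ≠ 0 ∧
      (∀ i j, Γ.W⁻¹ i j =
        Γ.weight (Γ.divergingForestsFromTo j i) / Γ.weight Γ.divergingForests) ∧
      ∀ i, ∑ j, Γ.W⁻¹ i j = 1) ∧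
    (∀ G : WeightedMultigraph V E, IsUnit G.W →
      G.weight G.rootedForests ≠ 0 ∧
      (∀ i j, G.W⁻¹ i j =
        G.weight (G.rootedForestsAt j i) / G.weight G.rootedForests) ∧
      ∀ i, ∑ j, G.W⁻¹ i j = 1) := by
  refine ⟨fun Γ hu => ?_, fun G hu => ?_⟩
  · obtain ⟨h0, h⟩ := inv_apply_eq_div Γ.det_W Γ.adjugate_W hu
    exact ⟨h0, h, sum_inv_row_eq_one Γ.W_row hu⟩
  · obtain ⟨h0, h⟩ := inv_apply_eq_div G.det_W G.adjugate_W hu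
    exact ⟨h0, h, sum_inv_row_eq_one G.W_row hu⟩
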